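/- Let $(N,\tilde g)$ be a smooth Riemannian manifold with Levi-Civita connection $\tilde\nabla$, and let $v$ be a smooth vector field on $N$ which is concurrent, i.e. $\tilde\nabla_X v = X$ for every vector field $X$ on $N$. Let $(M,g)$ be a Riemannian submanifold of $N$, i.e. a smooth Riemannian manifold with a smooth isometric immersion $\iota : M\to N$ (so that $g=\iota^*\tilde g$), and let $v^T$ be the tangential component of $v$ along $M$: the vector field on $M$ such that $d\iota_x(v^T(x))$ is the orthogonal projection of $v(\iota(x))$ to $d\iota_x(T_xM)$ for every $x\in M$. Suppose that $(M,g,v^T,\rho)$ is an almost Yamabe soliton, i.e. $v^T$ is a complete smooth vector field, $\rho : M\to\mathbb R$ is a smooth function, and $$(R-\rho)\,g=\tfrac12\,\mathcal L_{v^T}g ,$$ where $R$ is the scalar curvature of $(M,g)$ and $\mathcal L$ is the Lie derivative. Then $(M,g,v^T,\rho)$ is a gradient almost Yamabe soliton with potential $$f : M\to\mathbb R,\qquad f(x)=\tfrac12\,\tilde g\big(v(\iota(x)),v(\iota(x))\big)=\tfrac12\,|v(\iota(x))|^2 ,$$ that is, $(M,g,v^T,\rho)$ is an almost Yamabe soliton,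 $f$ is smooth, and $v^T=\nabla f$ is the gradient of $f$ on $(M,g)$. -/

import Mathlib

open Bundle FiberBundle
open scoped Manifold ContDiff

set_option linter.unusedSectionVars false

noncomputable section

namespace RiemannianSoliton

/-! ### The Levi-Civita connection of a Riemannian manifold, through the Koszul formula -/

section Connection

variable {E : Type*} [NormedAddCommGroup E] [NormedSpace ℝ E] [FiniteDimensional ℝ E]
  {H : Type*} [TopologicalSpace H] {I : ModelWithCorners ℝ E H}
  {M : Type*} [TopologicalSpace M] [ChartedSpace H M] [IsManifold I ∞ M]
  [RiemannianBundle (fun x : M ↦ TangentSpace I x)]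

instance finiteDimensional_tangentSpace (x : M) : FiniteDimensional ℝ (TangentSpace I x) :=
  inferInstanceAs (FiniteDimensional ℝ E)

instance completeSpace_tangentSpace (x : M) : CompleteSpace (TangentSpace I x) :=
  FiniteDimensional.complete ℝ _

variable (I) in
/-- The Koszul expression
`(X⟨Y,Z⟩ + Y⟨X,Z⟩ - Z⟨X,Y⟩ + ⟨[X,Y],Z⟩ - ⟨[X,Z],Y⟩ - ⟨[Y,Z],X⟩) / 2` at the point `x`,
which is the value of `⟨∇_X Y, Z⟩` for the Levi-Civita connection `∇`. -/
def koszul (Y X Z : Π x : M, TangentSpace I x) (x : M) : ℝ :=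
  (1 / 2) *
    (mvfderiv I (fun y ↦ inner ℝ (Y y) (Z y)) x (X x)
      + mvfderiv I (fun y ↦ inner ℝ (X y) (Z y)) x (Y x)
      - mvfderiv I (fun y ↦ inner ℝ (X y) (Y y)) x (Z x)
      + inner ℝ (VectorField.mlieBracket I X Y x) (Z x)
      - inner ℝ (VectorField.mlieBracket I X Z x) (Y x)
      - inner ℝ (VectorField.mlieBracket I Y Z x) (X x))

variable [IsContMDiffRiemannianBundle I ∞ E (fun x : M ↦ TangentSpace I x)]

theorem mdiff_inner {x : M} {X Y : Π x : M, TangentSpace I x} (hX : MDiffAt (T% X) x)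
    (hY : MDiffAt (T% Y) x) : MDiffAt (fun y ↦ inner ℝ (X y) (Y y)) x :=
  MDifferentiableAt.inner_bundle (F := E) (E := fun x : M ↦ TangentSpace I x) (IB := I)
    (b := fun x ↦ x) hX hY

theorem koszul_tensorial_left {x : M} {Y Z : Π x : M, TangentSpace I x}
    (hY : MDiffAt (T% Y) x) (hZ : MDiffAt (T% Z) x) :
    TensorialAt I E (fun X ↦ koszul I Y X Z x) x where
  smul {f X} hf hX := by
    simp only [koszul, Pi.smul_apply', inner_smul_left, conj_trivial]
    have : CompleteSpace E := FiniteDimensional.complete ℝ E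
    rw [mvfderiv_fun_mul hf (mdiff_inner hX hZ), mvfderiv_fun_mul hf (mdiff_inner hX hY),
      VectorField.mlieBracket_smul_left hf hX, VectorField.mlieBracket_smul_left hf hX]
    simp [inner_add_left, inner_smul_left, inner_smul_right, real_inner_comm]
    ring
  add {X X'} hX hX' := by
    simp only [koszul, Pi.add_apply, inner_add_left]
    have : CompleteSpace E := FiniteDimensional.complete ℝ E
    rw [mvfderiv_fun_add (mdiff_inner hX hZ) (mdiff_inner hX' hZ),
      mvfderiv_fun_add (mdiff_inner hX hY) (mdiff_inner hX' hY),
      VectorField.mlieBracket_add_left hX hX', VectorField.mlieBracket_add_left hX hX']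
    simp [inner_add_left, inner_add_right]
    ring

theorem koszul_tensorial_right {x : M} {Y X : Π x : M, TangentSpace I x}
    (hY : MDiffAt (T% Y) x) (hX : MDiffAt (T% X) x) :
    TensorialAt I E (fun Z ↦ koszul I Y X Z x) x where
  smul {f Z} hf hZ := by
    simp only [koszul, Pi.smul_apply', inner_smul_right]
    have : CompleteSpace E := FiniteDimensional.complete ℝ E
    rw [mvfderiv_fun_mul hf (mdiff_inner hY hZ), mvfderiv_fun_mul hf (mdiff_inner hX hZ),
      VectorField.mlieBracket_smul_right hf hZ, VectorField.mlieBracket_smul_right hf hZ]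
    simp [inner_add_left, inner_smul_left]
    rw [real_inner_comm (Z x) (Y x), real_inner_comm (Z x) (X x)]
    ring
  add {Z Z'} hZ hZ' := by
    simp only [koszul, Pi.add_apply, inner_add_right]
    have : CompleteSpace E := FiniteDimensional.complete ℝ E
    rw [mvfderiv_fun_add (mdiff_inner hY hZ) (mdiff_inner hY hZ'),
      mvfderiv_fun_add (mdiff_inner hX hZ) (mdiff_inner hX hZ'),
      VectorField.mlieBracket_add_right hZ hZ', VectorField.mlieBracket_add_right hZ hZ']
    simp [inner_add_left]
    ring

theorem koszul_add {x : M} {Y Y' X Z : Π x : M, TangentSpace I x}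
    (hY : MDiffAt (T% Y) x) (hY' : MDiffAt (T% Y') x)
    (hX : MDiffAt (T% X) x) (hZ : MDiffAt (T% Z) x) :
    koszul I (Y + Y') X Z x = koszul I Y X Z x + koszul I Y' X Z x := by
  simp only [koszul, Pi.add_apply, inner_add_left, inner_add_right]
  have : CompleteSpace E := FiniteDimensional.complete ℝ E
  rw [mvfderiv_fun_add (mdiff_inner hY hZ) (mdiff_inner hY' hZ),
    mvfderiv_fun_add (mdiff_inner hX hY) (mdiff_inner hX hY'),
    VectorField.mlieBracket_add_left hY hY', VectorField.mlieBracket_add_right hY hY']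
  simp [inner_add_left]
  ring

theorem koszul_smul {x : M} {f : M → ℝ} {Y X Z : Π x : M, TangentSpace I x}
    (hf : MDiffAt f x) (hY : MDiffAt (T% Y) x)
    (hX : MDiffAt (T% X) x) (hZ : MDiffAt (T% Z) x) :
    koszul I (f • Y) X Z x =
      f x * koszul I Y X Z x + mvfderiv I f x (X x) * inner ℝ (Y x) (Z x) := by
  simp only [koszul, Pi.smul_apply', inner_smul_left, inner_smul_right, conj_trivial]
  have : CompleteSpace E := FiniteDimensional.complete ℝ E
  rw [mvfderiv_fun_mul hf (mdiff_inner hY hZ), mvfderiv_fun_mul hf (mdiff_inner hX hY),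
    VectorField.mlieBracket_smul_left hf hY, VectorField.mlieBracket_smul_right hf hY]
  simp [inner_add_left, inner_smul_left, real_inner_comm]
  ring

/-- The Koszul expression as the bilinear form `(X, Z) ↦ ⟨∇_X Y, Z⟩` on the tangent space at `x`,
for a vector field `Y` which is differentiable at `x`. -/
def koszulForm (Y : Π x : M, TangentSpace I x) (x : M) (hY : MDiffAt (T% Y) x) :
    TangentSpace I x →L[ℝ] TangentSpace I x →L[ℝ] ℝ :=
  TensorialAt.mkHom₂ (F := E) (F' := E) (I := I) (fun X Z ↦ koszul I Y X Z x) x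
    (fun _ hZ ↦ koszul_tensorial_left hY hZ) (fun _ hX ↦ koszul_tensorial_right hY hX)

variable (I M) in
open Classical in
/-- The Levi-Civita connection of the Riemannian manifold `M`. At a point `x` where the vector
field `Y` is differentiable, `leviCivita I M Y x u` is the vector `∇_u Y` determined by the Koszul
formula (at the other points it has the conventional value zero). -/
def leviCivita : CovariantDerivative I E (fun x : M ↦ TangentSpace I x) where
  toFun Y x := if hY : MDiffAt (T% Y) x then
    InnerProductSpace.continuousLinearMapOfBilin (koszulForm Y x hY) else 0
  isCovariantDerivativeOnUniv :=
    { add := by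
        intro Y Y' x hY hY' _
        rw [dif_pos hY, dif_pos hY', dif_pos (mdifferentiableAt_add_section hY hY')]
        ext1 X₀
        refine ext_inner_right ℝ fun Z₀ ↦ ?_
        simp only [add_apply, inner_add_left,
          InnerProductSpace.continuousLinearMapOfBilin_apply]
        exact koszul_add hY hY' (mdifferentiableAt_extend ..) (mdifferentiableAt_extend ..)
      leibniz := by
        intro Y f x hY hf _
        rw [dif_pos hY, dif_pos (hf.smul_section hY)]
        ext1 X₀
        refine ext_inner_right ℝ fun Z₀ ↦ ?_
        simp only [add_apply, inner_add_left,
          InnerProductSpace.continuousLinearMapOfBilin_apply]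
        refine (koszul_smul hf hY (mdifferentiableAt_extend ..)
          (mdifferentiableAt_extend ..)).trans ?_
        have key (a : ℝ) (u w : TangentSpace I x) : inner ℝ (a • u) w = a * inner ℝ u w :=
          real_inner_smul_left u w a
        simp only [extend_apply_self, smul_apply,
          ContinuousLinearMap.smulRight_apply, key,
          InnerProductSpace.continuousLinearMapOfBilin_apply]
        rfl }

theorem inner_leviCivita {x : M} {X Y Z : Π x : M, TangentSpace I x}
    (hY : MDiffAt (T% Y) x) (hX : MDiffAt (T% X) x) (hZ : MDiffAt (T% Z) x) :
    inner ℝ (leviCivita I M Y x (X x)) (Z x) = koszul I Y X Z x := by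
  simp only [leviCivita, dif_pos hY, InnerProductSpace.continuousLinearMapOfBilin_apply]
  exact TensorialAt.mkHom₂_apply (F := E) (F' := E) (I := I) _ _ hX hZ

/-- The connection `leviCivita` has no torsion. -/
theorem leviCivita_torsion :
    haveI : CompleteSpace E := FiniteDimensional.complete ℝ E
    (leviCivita I M).torsion = 0 := by
  have : CompleteSpace E := FiniteDimensional.complete ℝ E
  rw [CovariantDerivative.torsion_eq_zero_iff]
  intro X Y x hX hY
  refine ext_inner_right ℝ fun Z₀ ↦ ?_
  have hZ := mdifferentiableAt_extend I E (V := fun x : M ↦ TangentSpace I x) Z₀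
  set Z := extend E (E := fun x : M ↦ TangentSpace I x) Z₀
  have e : Z x = Z₀ := extend_apply_self ..
  rw [← e, inner_sub_left, inner_leviCivita hY hX hZ, inner_leviCivita hX hY hZ]
  simp only [koszul]
  rw [VectorField.mlieBracket_swap_apply (V := Y) (W := X)]
  simp [real_inner_comm]
  ring

/-- The connection `leviCivita` is compatible with the metric. -/
theorem leviCivita_metric {x : M} {X Y Z : Π x : M, TangentSpace I x}
    (hX : MDiffAt (T% X) x) (hY : MDiffAt (T% Y) x) (hZ : MDiffAt (T% Z) x) :
    mvfderiv I (fun y ↦ inner ℝ (Y y) (Z y)) x (X x) =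
      inner ℝ (leviCivita I M Y x (X x)) (Z x) + inner ℝ (Y x) (leviCivita I M Z x (X x)) := by
  rw [real_inner_comm (leviCivita I M Z x (X x)) (Y x), inner_leviCivita hY hX hZ,
    inner_leviCivita hZ hX hY]
  simp only [koszul]
  rw [VectorField.mlieBracket_swap_apply (V := Z) (W := Y)]
  simp [real_inner_comm]
  ring

end Connection

/-! ### Curvature, gradient, Lie derivative of the metric, solitons -/

section Soliton

variable {E : Type*} [NormedAddCommGroup E] [NormedSpace ℝ E] [FiniteDimensional ℝ E]
  {H : Type*} [TopologicalSpace H] (I : ModelWithCorners ℝ E H)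
  {M : Type*} [TopologicalSpace M] [ChartedSpace H M] [IsManifold I ∞ M]
  [RiemannianBundle (fun x : M ↦ TangentSpace I x)]
  [IsContMDiffRiemannianBundle I ∞ E (fun x : M ↦ TangentSpace I x)]

/-- The Riemann curvature `Rm(X, Y)Z = ∇_X ∇_Y Z - ∇_Y ∇_X Z - ∇_[X, Y] Z` for vector fields. -/
def riemann (X Y Z : Π x : M, TangentSpace I x) (x : M) : TangentSpace I x :=
  leviCivita I M (fun y ↦ leviCivita I M Z y (Y y)) x (X x)
    - leviCivita I M (fun y ↦ leviCivita I M Z y (X y)) x (Y x)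
    - leviCivita I M Z x (VectorField.mlieBracket I X Y x)

/-- The curvature tensor at `x`, on tangent vectors at `x`: they are extended to vector fields
which are smooth near `x` (as `riemann` is tensorial, the extension does not matter). -/
def curvature (x : M) (u w z : TangentSpace I x) : TangentSpace I x :=
  riemann I (extend E (E := fun x : M ↦ TangentSpace I x) u)
    (extend E (E := fun x : M ↦ TangentSpace I x) w)
    (extend E (E := fun x : M ↦ TangentSpace I x) z) x

/-- The scalar curvature `R = ∑ᵢ ∑ⱼ ⟨Rm(eᵢ, eⱼ)eⱼ, eᵢ⟩`, for an orthonormal basis `e` of the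
tangent space (positive on round spheres). -/
def scalarCurvature (x : M) : ℝ :=
  ∑ i, ∑ j, inner ℝ
    (curvature I x (stdOrthonormalBasis ℝ (TangentSpace I x) i)
      (stdOrthonormalBasis ℝ (TangentSpace I x) j) (stdOrthonormalBasis ℝ (TangentSpace I x) j))
    (stdOrthonormalBasis ℝ (TangentSpace I x) i)

/-- The Lie derivative of the metric,
`(𝓛_v g)(X, Y) = v(g(X, Y)) - g([v, X], Y) - g(X, [v, Y])`, at the point `x`. -/
def lieDerivMetric (v X Y : Π x : M, TangentSpace I x) (x : M) : ℝ :=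
  mvfderiv I (fun y ↦ inner ℝ (X y) (Y y)) x (v x)
    - inner ℝ (VectorField.mlieBracket I v X x) (Y x)
    - inner ℝ (X x) (VectorField.mlieBracket I v Y x)

/-- The gradient of a function: the vector field with `⟨∇f, u⟩ = df(u)` for all `u`. -/
def gradient (f : M → ℝ) (x : M) : TangentSpace I x :=
  (InnerProductSpace.toDual ℝ (TangentSpace I x)).symm (mvfderiv I f x)

/-- A smooth vector field. -/
def IsSmoothVectorField (v : Π x : M, TangentSpace I x) : Prop :=
  ContMDiff I I.tangent ∞ (fun x ↦ (⟨x, v x⟩ : TangentBundle I M))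

/-- A vector field is complete if through every point there is an integral curve which is defined
for all times. -/
def IsCompleteVectorField (v : Π x : M, TangentSpace I x) : Prop :=
  ∀ x : M, ∃ γ : ℝ → M, γ 0 = x ∧ IsMIntegralCurve γ v

/-- A (smooth) vector field `v` is concurrent if `∇_X v = X` for all `X`, where `∇` is the
Levi-Civita connection. -/
structure IsConcurrent (v : Π x : M, TangentSpace I x) : Prop where
  smooth : IsSmoothVectorField I v
  cov_eq : ∀ (x : M) (u : TangentSpace I x), leviCivita I M v x u = u

/-- `(M, g, v, ρ)` is an almost Yamabe soliton: `v` is a complete smooth vector field and `ρ` a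
smooth function such that `(R - ρ) g = (1/2) 𝓛_v g`. The identity between tensors is tested at
every point on the vector fields which are smooth near that point. -/
structure IsAlmostYamabeSoliton (v : Π x : M, TangentSpace I x) (ρ : M → ℝ) : Prop where
  smooth_field : IsSmoothVectorField I v
  complete : IsCompleteVectorField I v
  smooth_fun : ContMDiff I 𝓘(ℝ, ℝ) ∞ ρ
  eqn : ∀ (x : M) (X Y : Π x : M, TangentSpace I x),
    ContMDiffAt I I.tangent ∞ (fun y ↦ (⟨y, X y⟩ : TangentBundle I M)) x →
    ContMDiffAt I I.tangent ∞ (fun y ↦ (⟨y, Y y⟩ : TangentBundle I M)) x →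
    (scalarCurvature I x - ρ x) * inner ℝ (X x) (Y x) = (1 / 2) * lieDerivMetric I v X Y x

/-- The almost Yamabe soliton `(M, g, v, ρ)` is a gradient almost Yamabe soliton with potential
`f`: the function `f` is smooth and `v` is its gradient. -/
structure IsGradientAlmostYamabeSoliton (v : Π x : M, TangentSpace I x) (ρ f : M → ℝ) : Prop where
  soliton : IsAlmostYamabeSoliton I v ρ
  smooth_potential : ContMDiff I 𝓘(ℝ, ℝ) ∞ f
  eq_gradient : ∀ x : M, v x = gradient I f x

end Soliton

/-! ### Submanifolds -/

section Submanifold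

variable {E : Type*} [NormedAddCommGroup E] [NormedSpace ℝ E] [FiniteDimensional ℝ E]
  {H : Type*} [TopologicalSpace H] (I : ModelWithCorners ℝ E H)
  {M : Type*} [TopologicalSpace M] [ChartedSpace H M] [IsManifold I ∞ M]
  [RiemannianBundle (fun x : M ↦ TangentSpace I x)]
  {E' : Type*} [NormedAddCommGroup E'] [NormedSpace ℝ E'] [FiniteDimensional ℝ E']
  {H' : Type*} [TopologicalSpace H'] (J : ModelWithCorners ℝ E' H')
  {N : Type*} [TopologicalSpace N] [ChartedSpace H' N] [IsManifold J ∞ N]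
  [RiemannianBundle (fun y : N ↦ TangentSpace J y)]

/-- The smooth map `ι : M → N` makes `M`, with its Riemannian metric `g`, a Riemannian submanifold
of `N`: the metric `g` is the one induced by `ι`. (The differentials are then injective, so `ι` is
an immersion. It need not be an embedding.) -/
structure IsIsometricImmersion (ι : M → N) : Prop where
  smooth : ContMDiff I J ∞ ι
  inner_eq : ∀ (x : M) (u w : TangentSpace I x),
    inner ℝ (mfderiv I J ι x u) (mfderiv I J ι x w) = inner ℝ u w

variable {I J}

theorem IsIsometricImmersion.injective_mfderiv {ι : M → N} (hι : IsIsometricImmersion I J ι)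
    (x : M) : Function.Injective (mfderiv I J ι x).toLinearMap := by
  rw [← LinearMap.ker_eq_bot, LinearMap.ker_eq_bot']
  intro u hu
  have h := hι.inner_eq x u u
  have hu' : mfderiv I J ι x u = 0 := hu
  rw [hu', inner_zero_left] at h
  exact inner_self_eq_zero.1 h.symm

/-- The tangential component `vᵀ` along `M` of a vector field `v` on `N`: the vector field on `M`
whose image under the differential `dι` is, at `x`, the orthogonal projection of `v (ι x)` to the
subspace `dι (T_x M)` of the tangent space of `N` at `ι x`. -/
def IsIsometricImmersion.tangentialPart {ι : M → N} (hι : IsIsometricImmersion I J ι)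
    (v : Π y : N, TangentSpace J y) (x : M) : TangentSpace I x :=
  (LinearEquiv.ofInjective (mfderiv I J ι x).toLinearMap (hι.injective_mfderiv x)).symm
    ((LinearMap.range (mfderiv I J ι x).toLinearMap).orthogonalProjectionOnto (v (ι x)))

end Submanifold

end RiemannianSoliton

end

namespace RiemannianSoliton

section Concurrent

variable {E : Type*} [NormedAddCommGroup E] [NormedSpace ℝ E] [FiniteDimensional ℝ E]
  {H : Type*} [TopologicalSpace H] {I : ModelWithCorners ℝ E H}
  {M : Type*} [TopologicalSpace M] [ChartedSpace H M] [IsManifold I ∞ M]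
  [RiemannianBundle (fun x : M ↦ TangentSpace I x)]
  [IsContMDiffRiemannianBundle I ∞ E (fun x : M ↦ TangentSpace I x)]

/-- Half the square norm of a smooth vector field is smooth. -/
theorem IsSmoothVectorField.contMDiff_half_norm_sq {v : Π x : M, TangentSpace I x}
    (hv : IsSmoothVectorField I v) : ContMDiff I 𝓘(ℝ, ℝ) ∞ (fun x ↦ ‖v x‖ ^ 2 / 2) := by
  have h : ContMDiff I 𝓘(ℝ, ℝ) ∞ (fun x ↦ inner ℝ (v x) (v x)) :=
    ContMDiff.inner_bundle (F := E) (E := fun x : M ↦ TangentSpace I x) (IB := I)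
      (b := fun x ↦ x) hv hv
  simp only [real_inner_self_eq_norm_sq] at h
  simp only [div_eq_mul_inv]
  exact h.mul contMDiff_const

/-- The differential of half the square norm of a concurrent vector field `v` is `⟨v, ·⟩`. -/
theorem IsConcurrent.mvfderiv_half_norm_sq {v : Π x : M, TangentSpace I x}
    (hv : IsConcurrent I v) (x : M) (u : TangentSpace I x) :
    mvfderiv I (fun y ↦ ‖v y‖ ^ 2 / 2) x u = inner ℝ (v x) u := by
  have hvx : MDiffAt (T% v) x := (hv.smooth x).mdifferentiableAt (by simp)
  have hU := mdifferentiableAt_extend I E (V := fun x : M ↦ TangentSpace I x) u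
  have h := leviCivita_metric hU hvx hvx
  simp only [extend_apply_self, hv.cov_eq] at h
  have hc : MDiffAt (fun _ : M ↦ (2 : ℝ)⁻¹) x := mdifferentiableAt_const
  have hf : (fun y ↦ ‖v y‖ ^ 2 / 2) = fun y ↦ inner ℝ (v y) (v y) * (2 : ℝ)⁻¹ := by
    funext y
    rw [real_inner_self_eq_norm_sq, div_eq_mul_inv]
  rw [hf, mvfderiv_fun_mul (mdiff_inner hvx hvx) hc]
  have h0 : mvfderiv I (fun _ : M ↦ (2 : ℝ)⁻¹) x = 0 := mvfderiv_const _
  rw [h0]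
  rw [real_inner_comm (v x) u] at h
  simp only [smul_zero, zero_add, smul_apply, smul_eq_mul, h]
  ring

end Concurrent

section Submanifold

variable {E : Type*} [NormedAddCommGroup E] [NormedSpace ℝ E] [FiniteDimensional ℝ E]
  {H : Type*} [TopologicalSpace H] {I : ModelWithCorners ℝ E H}
  {M : Type*} [TopologicalSpace M] [ChartedSpace H M] [IsManifold I ∞ M]
  [RiemannianBundle (fun x : M ↦ TangentSpace I x)]
  {E' : Type*} [NormedAddCommGroup E'] [NormedSpace ℝ E'] [FiniteDimensional ℝ E']
  {H' : Type*} [TopologicalSpace H'] {J : ModelWithCorners ℝ E' H'}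
  {N : Type*} [TopologicalSpace N] [ChartedSpace H' N] [IsManifold J ∞ N]
  [RiemannianBundle (fun y : N ↦ TangentSpace J y)]

/-- The tangential part of `v` is the adjoint of the differential, applied to `v`. -/
theorem IsIsometricImmersion.inner_tangentialPart {ι : M → N} (hι : IsIsometricImmersion I J ι)
    (v : Π y : N, TangentSpace J y) (x : M) (u : TangentSpace I x) :
    inner ℝ (hι.tangentialPart v x) u = inner ℝ (v (ι x)) (mfderiv I J ι x u) := by
  have h : mfderiv I J ι x (hι.tangentialPart v x) =
      ((LinearMap.range (mfderiv I J ι x).toLinearMap).orthogonalProjectionOnto (v (ι x)) :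
        TangentSpace J (ι x)) :=
    congrArg Subtype.val (LinearEquiv.apply_symm_apply
      (LinearEquiv.ofInjective (mfderiv I J ι x).toLinearMap (hι.injective_mfderiv x)) _)
  rw [← hι.inner_eq, h]
  exact Submodule.inner_orthogonalProjectionOnto_eq_of_mem_right
    (K := LinearMap.range (mfderiv I J ι x).toLinearMap) ⟨_, ⟨u, rfl⟩⟩ (v (ι x))

/-- The tangential part of a concurrent vector field `v` is the gradient of `|v|² / 2` along the
submanifold. -/
theorem IsIsometricImmersion.tangentialPart_eq_gradient
    [IsContMDiffRiemannianBundle I ∞ E (fun x : M ↦ TangentSpace I x)]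
    [IsContMDiffRiemannianBundle J ∞ E' (fun y : N ↦ TangentSpace J y)]
    {ι : M → N} (hι : IsIsometricImmersion I J ι) {v : Π y : N, TangentSpace J y}
    (hv : IsConcurrent J v) (x : M) :
    hι.tangentialPart v x = gradient I (fun x ↦ ‖v (ι x)‖ ^ 2 / 2) x := by
  refine ext_inner_right ℝ fun u ↦ ?_
  have hf : MDifferentiableAt J 𝓘(ℝ, ℝ) (fun y ↦ ‖v y‖ ^ 2 / 2) (ι x) :=
    (hv.smooth.contMDiff_half_norm_sq (ι x)).mdifferentiableAt (by simp)
  have hιx : MDifferentiableAt I J ι x := (hι.smooth x).mdifferentiableAt (by simp)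
  rw [hι.inner_tangentialPart, gradient, InnerProductSpace.toDual_symm_apply,
    ← hv.mvfderiv_half_norm_sq]
  exact (mvfderiv_comp_apply x hf hιx u).symm

end Submanifold

end RiemannianSoliton

theorem proposition4p2 {m n : ℕ}
    {N : Type*} [TopologicalSpace N] [ChartedSpace (EuclideanSpace ℝ (Fin m)) N]
    [IsManifold (𝓡 m) ∞ N] [RiemannianBundle (fun y : N ↦ TangentSpace (𝓡 m) y)]
    [IsContMDiffRiemannianBundle (𝓡 m) ∞ (EuclideanSpace ℝ (Fin m))
      (fun y : N ↦ TangentSpace (𝓡 m) y)]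
    {M : Type*} [TopologicalSpace M] [ChartedSpace (EuclideanSpace ℝ (Fin n)) M]
    [IsManifold (𝓡 n) ∞ M] [RiemannianBundle (fun x : M ↦ TangentSpace (𝓡 n) x)]
    [IsContMDiffRiemannianBundle (𝓡 n) ∞ (EuclideanSpace ℝ (Fin n))
      (fun x : M ↦ TangentSpace (𝓡 n) x)]
    (v : Π y : N, TangentSpace (𝓡 m) y) (hv : RiemannianSoliton.IsConcurrent (𝓡 m) v)
    (ι : M → N) (hι : RiemannianSoliton.IsIsometricImmersion (𝓡 n) (𝓡 m) ι)
    (ρ : M → ℝ)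
    (hsol : RiemannianSoliton.IsAlmostYamabeSoliton (𝓡 n) (hι.tangentialPart v) ρ) :
    RiemannianSoliton.IsGradientAlmostYamabeSoliton (𝓡 n) (hι.tangentialPart v) ρ
      (fun x ↦ ‖v (ι x)‖ ^ 2 / 2) :=
  ⟨hsol, hv.smooth.contMDiff_half_norm_sq.comp hι.smooth, hι.tangentialPart_eq_gradient hv⟩
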